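/- A finite simple graph $G$ is *$k$-linked* if for any $2k$ distinct vertices $s_1,\dots,s_k,t_1,\dots,t_k$ of $G$ there are pairwise disjoint paths $P_1,\dots,P_k$ in $G$ such that $P_i$ has end vertices $s_i$ and $t_i$ for $i=1,\dots,k$. Let $\kappa(G)$ denote the connectivity of $G$, that is, the greatest $p$ such that $G$ has more than $p$ vertices and $G-X$ is connected for every set $X$ of fewer than $p$ vertices; let $\mathrm{tw}(G)$ denote the tree-width of $G$ and $|G|$ its number of vertices. **Proposition.** For all integers $k$ and $N$ with $k\ge 2$ there is a finite simple graph $G$ which is not $k$-linked such that $$\kappa(G)\ge 2k+1,\qquad \mathrm{tw}(G)\le 2k+10,\quad\text{and}\quad |G|\ge N.$$ -/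

import Mathlib

namespace SimpleGraph

universe u

variable {V : Type u} (G : SimpleGraph V)

/-- `G` is `k`-linked: for all distinct vertices `s₁, …, s_k, t₁, …, t_k` there are pairwise
disjoint paths `P₁, …, P_k` in `G` such that `P_i` has end vertices `s_i` and `t_i`. -/
def IsLinked (k : ℕ) : Prop :=
  ∀ s t : Fin k → V, Function.Injective (Sum.elim s t) →
    ∃ P : ∀ i : Fin k, G.Path (s i) (t i),
      ∀ i j : Fin k, i ≠ j →
        List.Disjoint (P i : G.Walk (s i) (t i)).support (P j : G.Walk (s j) (t j)).support

/-- `G` is `p`-connected: it has more than `p` vertices, and deleting fewer than `p` vertices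
always leaves a connected graph. -/
def IsVertexConnected (p : ℕ) : Prop :=
  (p : ℕ∞) < ENat.card V ∧
    ∀ X : Finset V, X.card < p → (G.induce {v : V | v ∉ X}).Connected

/-- The connectivity `κ(G)`: the greatest `p` such that `G` is `p`-connected. -/
noncomputable def connectivity : ℕ∞ :=
  ⨆ (p : ℕ) (_ : G.IsVertexConnected p), (p : ℕ∞)

/-- A tree-decomposition of `G`: a tree `T` with a bag of vertices of `G` for every node, such that
the bags cover the vertices and the edges of `G`, and for every vertex `v` of `G` the nodes whose
bag contains `v` induce a connected subtree of `T`. -/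
structure TreeDecomposition where
  /-- the nodes of the tree -/
  Node : Type u
  /-- the tree -/
  tree : SimpleGraph Node
  isTree : tree.IsTree
  /-- the bags -/
  bag : Node → Set V
  exists_mem_bag : ∀ v : V, ∃ n : Node, v ∈ bag n
  exists_edge_bag : ∀ v w : V, G.Adj v w → ∃ n : Node, v ∈ bag n ∧ w ∈ bag n
  connected_bags : ∀ v : V, (tree.induce {n : Node | v ∈ bag n}).Connected

variable {G} in
/-- The width of a tree-decomposition: the largest size of a bag, minus one. (The subtraction is
truncated only if all bags are empty, that is, only if `G` has no vertices.) -/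
noncomputable def TreeDecomposition.width (D : G.TreeDecomposition) : ℕ∞ :=
  (⨆ n : D.Node, (D.bag n).encard) - 1

/-- The tree-width of `G`: the minimum width of a tree-decomposition of `G`. -/
noncomputable def treewidth : ℕ∞ :=
  ⨅ D : G.TreeDecomposition, D.width

end SimpleGraph

/-! Take a triangulation of the sphere made of many concentric 5-rings with a cap at each end, and
omit the edge between u = (1,0) and v = (1,1). The two triangles at that edge merge into a
quadrilateral face on which u, v alternate with a = (0,0), b = (2,1). By planarity no u–v path is
disjoint from an a–b path, although the graph is still 5-connected. Now join it to 2(k-2)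
independent vertices and make all of these terminals of the other k-2 pairs. Paths for the first two
pairs must then stay in the planar part, so the join is not k-linked. Its connectivity is at least 5
+ 2(k-2) = 2k+1. Enumerating the cylinder ring by ring gives bandwidth at most 6, hence tree-width
at most 6 + 2(k-2) = 2k+2, whatever the number of rings.

Planarity enters only through crossing parities of explicit rays (`exists_mem_support_of_rays`,
`ray_region`, `ray_separator`). Connectivity is `reachable_avoiding` with
`isVertexConnected_joinEdgeless`. -/

namespace SimpleGraph

/-! ### Path-decompositions from bandwidth -/

section Width

theorem hasse_nat_adj {s t : ℕ} : (hasse ℕ).Adj s t ↔ s + 1 = t ∨ t + 1 = s := by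
  simp [hasse_adj, Order.covBy_iff_add_one_eq]

theorem isTree_hasse_nat : (hasse ℕ).IsTree := by
  refine ⟨⟨hasse_preconnected_of_succ ℕ⟩, ?_⟩
  rw [isAcyclic_iff_forall_isBridge]
  have key : ∀ t : ℕ, (hasse ℕ).IsBridge s(t, t + 1) := by
    intro t
    rw [isBridge_iff]
    rintro ⟨p⟩
    -- Without the edge from t to t + 1, a walk cannot leave the initial segment up to t.
    have aux : ∀ {x y : ℕ} (_ : ((hasse ℕ).deleteEdges {s(t, t + 1)}).Walk x y), x ≤ t → y ≤ t := by
      intro x y q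
      induction q with
      | nil => exact id
      | cons h _ ih =>
        intro hx
        apply ih
        simp only [deleteEdges_adj, hasse_nat_adj, Set.mem_singleton_iff, Sym2.eq_iff] at h
        omega
    have := aux p le_rfl
    omega
  intro e he
  induction e using Sym2.ind with
  | _ s t =>
    rw [mem_edgeSet, hasse_nat_adj] at he
    rcases he with rfl | rfl
    · exact key s
    · rw [Sym2.eq_swap]; exact key t

theorem connected_induce_hasse_nat (S : Set ℕ) (a : ℕ) (ha : a ∈ S)
    (h : ∀ t ∈ S, t ≠ a → t < a ∧ t + 1 ∈ S ∨ a < t ∧ t - 1 ∈ S) :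
    ((hasse ℕ).induce S).Connected := by
  have up : ∀ d t : ℕ, ∀ ht : t ∈ S, t + d = a →
      ((hasse ℕ).induce S).Reachable ⟨t, ht⟩ ⟨a, ha⟩ := by
    intro d
    induction d with
    | zero => rintro t ht rfl; exact Reachable.refl _
    | succ d ih =>
      intro t ht hd
      rcases h t ht (by omega) with ⟨_, h2⟩ | ⟨h1, _⟩
      · refine Reachable.trans (Adj.reachable ?_) (ih (t + 1) h2 (by omega))
        simp
      · omega
  have down : ∀ d t : ℕ, ∀ ht : t ∈ S, t = a + d →
      ((hasse ℕ).induce S).Reachable ⟨t, ht⟩ ⟨a, ha⟩ := by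
    intro d
    induction d with
    | zero => rintro t ht rfl; exact Reachable.refl _
    | succ d ih =>
      intro t ht hd
      rcases h t ht (by omega) with ⟨h1, _⟩ | ⟨_, h2⟩
      · omega
      · refine Reachable.trans (Adj.reachable ?_) (ih (t - 1) h2 (by omega))
        simp only [comap_adj, Function.Embedding.subtype_apply, hasse_nat_adj]
        omega
  refine (connected_iff_exists_forall_reachable _).2 ⟨⟨a, ha⟩, fun ⟨t, ht⟩ => ?_⟩
  rcases le_total t a with hta | hta
  · exact (up (a - t) t ht (by omega)).symm
  · exact (down (t - a) t ht (by omega)).symm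

/-- A graph which has bandwidth at most `b` after deleting at most `c` vertices has tree-width at
most `b + c`. -/
theorem treewidth_le_of_bandwidth {V : Type} (G : SimpleGraph V) (S : Set V) (pos : V → ℕ)
    (b c : ℕ) (hS : S.encard ≤ c) (hpos : Set.InjOn pos Sᶜ)
    (hb : ∀ x y, G.Adj x y → x ∉ S → y ∉ S → pos y ≤ pos x + b) :
    G.treewidth ≤ ((b + c : ℕ) : ℕ∞) := by
  -- The tree is the one-way infinite path; the bags are `S` plus a sliding window of b + 1
  -- consecutive positions.
  let D : G.TreeDecomposition :=
    { Node := ℕ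
      tree := hasse ℕ
      isTree := isTree_hasse_nat
      bag := fun t => S ∪ {v | v ∉ S ∧ t ≤ pos v ∧ pos v ≤ t + b}
      exists_mem_bag := fun v => ⟨pos v, by by_cases hv : v ∈ S <;> simp [hv]⟩
      exists_edge_bag := by
        intro v w h
        by_cases hv : v ∈ S
        · exact ⟨pos w, by by_cases hw : w ∈ S <;> simp [hv, hw]⟩
        by_cases hw : w ∈ S
        · exact ⟨pos v, by simp [hv, hw]⟩
        have h1 := hb v w h hv hw
        have h2 := hb w v h.symm hw hv
        refine ⟨min (pos v) (pos w), ?_⟩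
        simp only [Set.mem_union, Set.mem_ofPred_eq, hv, hw, false_or, not_false_eq_true, true_and]
        omega
      connected_bags := by
        intro v
        refine connected_induce_hasse_nat _ (pos v) ?_ ?_
        · by_cases hv : v ∈ S <;> simp [hv]
        · intro t ht hne
          by_cases hv : v ∈ S
          · simp only [Set.mem_union, Set.mem_ofPred_eq, hv, true_or, and_true]
            omega
          · simp only [Set.mem_union, Set.mem_ofPred_eq, hv, false_or, not_false_eq_true,
              true_and] at ht ⊢
            omega }
  refine (iInf_le _ D).trans ?_
  have hbag : ∀ t, (D.bag t).encard ≤ ((b + c : ℕ) : ℕ∞) + 1 := by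
    intro t
    refine (Set.encard_union_le _ _).trans ?_
    have h1 : {v | v ∉ S ∧ t ≤ pos v ∧ pos v ≤ t + b}.encard ≤ ((b + 1 : ℕ) : ℕ∞) := by
      have hinj : Set.InjOn pos {v | v ∉ S ∧ t ≤ pos v ∧ pos v ≤ t + b} :=
        hpos.mono fun v hv => hv.1
      rw [← hinj.encard_image]
      calc _ ≤ ((Finset.Icc t (t + b) : Finset ℕ) : Set ℕ).encard := by
            apply Set.encard_le_encard
            rintro _ ⟨v, hv, rfl⟩
            simpa using hv.2
        _ = _ := by
            rw [Set.encard_coe_eq_coe_finsetCard, Nat.card_Icc]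
            congr 1
            omega
    calc _ ≤ (c : ℕ∞) + ((b + 1 : ℕ) : ℕ∞) := add_le_add hS h1
      _ = _ := by push_cast; ring
  unfold TreeDecomposition.width
  exact tsub_le_iff_right.2 (iSup_le hbag)

end Width

/-! ### Deleting vertices -/

section Connectivity

variable {V : Type*} (G : SimpleGraph V)

/-- The graph obtained from `G` by deleting all edges which meet `X`. -/
def avoiding (X : Finset V) : SimpleGraph V where
  Adj x y := G.Adj x y ∧ x ∉ X ∧ y ∉ X
  symm := ⟨fun _ _ h => ⟨h.1.symm, h.2.2, h.2.1⟩⟩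
  loopless := ⟨fun _ h => h.1.ne rfl⟩

variable {G}

/-- Lets connectivity be argued in `avoiding X`, which keeps the vertex type `V` and so needs no
subtypes. -/
theorem reachable_induce_of_avoiding {X : Finset V} {x y : V} (hx : x ∉ X) (hy : y ∉ X)
    (h : (G.avoiding X).Reachable x y) :
    (G.induce {v | v ∉ X}).Reachable ⟨x, hx⟩ ⟨y, hy⟩ := by
  obtain ⟨p⟩ := h
  induction p with
  | nil => exact Reachable.refl _
  | cons h _ ih => exact Reachable.trans (Adj.reachable (by simpa using h.1)) (ih h.2.2 hy)

theorem exists_fiber_avoiding {β : Type*} [Fintype β] [DecidableEq β] (f : V → β) (X : Finset V)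
    (h : X.card < Fintype.card β) : ∃ c, ∀ x, f x = c → x ∉ X := by
  by_contra! hc
  have : X.image f = Finset.univ := by
    ext c
    obtain ⟨x, hx, hxX⟩ := hc c
    simpa using ⟨x, hxX, hx⟩
  have h1 := Finset.card_image_le (s := X) (f := f)
  rw [this, Finset.card_univ] at h1
  omega

theorem le_connectivity {p : ℕ} (h : G.IsVertexConnected p) : (p : ℕ∞) ≤ G.connectivity :=
  le_iSup₂_of_le p h le_rfl

end Connectivity

/-! ### Joins with edgeless graphs -/

section Join

variable {V K : Type*} (G : SimpleGraph V)

/-- The join of `G` with the edgeless graph on `K`. -/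
def joinEdgeless (K : Type*) : SimpleGraph (V ⊕ K) :=
  (G ⊕g (⊥ : SimpleGraph K)) ⊔ completeBipartiteGraph V K

variable {G}

theorem joinEdgeless_adj_inl {x y : V} :
    (G.joinEdgeless K).Adj (Sum.inl x) (Sum.inl y) ↔ G.Adj x y := by
  simp [joinEdgeless]

theorem joinEdgeless_adj_inl_inr {x : V} {y : K} :
    (G.joinEdgeless K).Adj (Sum.inl x) (Sum.inr y) := by
  simp [joinEdgeless]

/-- Joining `G` with an edgeless graph on `c` vertices raises the connectivity by `c`, provided
`G` is large enough. -/
theorem isVertexConnected_joinEdgeless [Fintype V] [Fintype K] {p : ℕ}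
    (hV : p + Fintype.card K < Fintype.card V)
    (hG : ∀ X : Finset V, X.card < p → ∀ x y, x ∉ X → y ∉ X → (G.avoiding X).Reachable x y) :
    (G.joinEdgeless K).IsVertexConnected (p + Fintype.card K) := by
  classical
  refine ⟨?_, fun X hX => ?_⟩
  · rw [ENat.card_eq_coe_fintype_card, Fintype.card_sum]
    exact_mod_cast (by omega)
  obtain ⟨x, hx⟩ : ∃ x : V, Sum.inl x ∉ X := by
    by_contra! h
    have := Finset.card_le_card (s := Finset.univ.map Function.Embedding.inl) (t := X)
      (by intro y; simp only [Finset.mem_map]; rintro ⟨v, -, rfl⟩; exact h v)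
    rw [Finset.card_map, Finset.card_univ] at this
    omega
  refine (connected_iff_exists_forall_reachable _).2 ⟨⟨Sum.inl x, hx⟩, ?_⟩
  rintro ⟨y | z, hy⟩
  · apply reachable_induce_of_avoiding
    -- A surviving vertex of `K` is a common neighbour. Otherwise `X` contains all of `K`, and fewer
    -- than p deletions remain for `G`.
    by_cases hK : ∃ z : K, Sum.inr z ∉ X
    · obtain ⟨z, hz⟩ := hK
      have h1 : ((G.joinEdgeless K).avoiding X).Adj (Sum.inl x) (Sum.inr z) :=
        ⟨joinEdgeless_adj_inl_inr, hx, hz⟩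
      have h2 : ((G.joinEdgeless K).avoiding X).Adj (Sum.inl y) (Sum.inr z) :=
        ⟨joinEdgeless_adj_inl_inr, hy, hz⟩
      exact h1.reachable.trans h2.symm.reachable
    · push Not at hK
      let Y : Finset V := X.toLeft
      have hR : X.toRight = Finset.univ := by ext z; simpa using hK z
      have hc := X.card_toLeft_add_card_toRight
      rw [hR, Finset.card_univ] at hc
      have hr := hG Y (by show X.toLeft.card < p; omega) x y (by simpa [Y] using hx)
        (by simpa [Y] using hy)
      let φ : G.avoiding Y →g (G.joinEdgeless K).avoiding X :=
        { toFun := Sum.inl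
          map_rel' := fun {v w} h => ⟨joinEdgeless_adj_inl.2 h.1, by simpa [Y] using h.2.1,
            by simpa [Y] using h.2.2⟩ }
      exact hr.map φ
  · apply reachable_induce_of_avoiding
    exact Adj.reachable ⟨joinEdgeless_adj_inl_inr, hx, hy⟩

/-- A walk in the join of `G` with an edgeless graph that avoids the edgeless part is a walk
in `G`. -/
theorem exists_walk_of_joinEdgeless {x y : V} (p : (G.joinEdgeless K).Walk (Sum.inl x) (Sum.inl y))
    (hp : ∀ z : K, Sum.inr z ∉ p.support) :
    ∃ q : G.Walk x y, ∀ v ∈ q.support, Sum.inl v ∈ p.support := by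
  generalize hs : (Sum.inl x : V ⊕ K) = s at p
  generalize ht : (Sum.inl y : V ⊕ K) = t at p
  induction p generalizing x with
  | nil =>
    subst hs
    cases ht
    exact ⟨Walk.nil, by simp⟩
  | @cons s w t h p ih =>
    subst hs
    simp only [Walk.support_cons, List.mem_cons, not_or] at hp
    rcases w with w | z
    · obtain ⟨q, hq⟩ := ih rfl ht (fun z => (hp z).2)
      refine ⟨Walk.cons (joinEdgeless_adj_inl.1 h) q, fun v hv => ?_⟩
      simp only [Walk.support_cons, List.mem_cons] at hv ⊢
      exact hv.imp (congrArg _) (hq v)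
    · exact absurd p.start_mem_support (hp z).2

end Join

/-! ### A parity form of the Jordan curve theorem -/

section Crossing

variable {V : Type*} {G : SimpleGraph V}

/-- A coboundary telescopes modulo 2. -/
theorem Walk.sum_darts_eq_add {x y : V} (p : G.Walk x y) (c : V → V → ZMod 2) (f : V → ZMod 2)
    (h : ∀ d ∈ p.darts, c d.fst d.snd = f d.fst + f d.snd) :
    (p.darts.map fun d => c d.fst d.snd).sum = f x + f y := by
  induction p with
  | nil => simp [CharTwo.add_self_eq_zero]
  | @cons u v w huv q ih =>
    simp only [Walk.darts_cons, List.map_cons, List.sum_cons]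
    rw [ih fun d hd => h d (by simp [hd]), h ⟨(u, v), huv⟩ (by simp)]
    linear_combination CharTwo.add_self_eq_zero (f v)

theorem Walk.eq_of_forall_darts {x y : V} {α : Type*} (p : G.Walk x y) (Φ : V → α)
    (h : ∀ d ∈ p.darts, Φ d.fst = Φ d.snd) : Φ x = Φ y := by
  induction p with
  | nil => rfl
  | @cons u v w huv q ih =>
    exact (h ⟨(u, v), huv⟩ (by simp)).trans (ih fun d hd => h d (by simp [hd]))

/-- An algebraic form of the Jordan curve theorem. Think of `φ w` as the set of edges met by a ray
from the vertex `w`. If the rays from adjacent vertices differ by a coboundary and those from `a`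
and `b` differ by a coboundary plus the extra edge `uv`, then no `u`–`v` walk is disjoint from an
`a`–`b` walk. -/
theorem exists_mem_support_of_rays (φ : V → V → V → ZMod 2) {u v a b : V}
    (hloc : ∀ w w', G.Adj w w' → ∃ f : V → ZMod 2, ∀ x y, (G.Adj x y ∨ x = u ∧ y = v) →
      x ≠ w → x ≠ w' → y ≠ w → y ≠ w' → φ w x y + φ w' x y = f x + f y)
    (hsep : ∃ g : V → ZMod 2,
      (∀ x y, G.Adj x y → x ≠ a → x ≠ b → y ≠ a → y ≠ b → φ a x y + φ b x y = g x + g y) ∧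
      φ a u v + φ b u v = g u + g v + 1)
    (p : G.Walk u v) (q : G.Walk a b) : ∃ x ∈ p.support, x ∈ q.support := by
  by_contra! hpq
  let Φ : V → ZMod 2 := fun w => (p.darts.map fun d => φ w d.fst d.snd).sum + φ w u v
  have hne : ∀ x ∈ p.support, ∀ y ∈ q.support, x ≠ y := fun x hx y hy h => hpq x hx (h ▸ hy)
  have hsum : ∀ w w' : V, (p.darts.map fun d => φ w d.fst d.snd + φ w' d.fst d.snd).sum =
      (p.darts.map fun d => φ w d.fst d.snd).sum + (p.darts.map fun d => φ w' d.fst d.snd).sum :=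
    fun w w' => List.sum_map_add
  have h1 : Φ a = Φ b := by
    refine q.eq_of_forall_darts Φ fun d hd => ?_
    obtain ⟨f, hf⟩ := hloc _ _ d.adj
    have hd1 := q.dart_fst_mem_support_of_mem_darts hd
    have hd2 := q.dart_snd_mem_support_of_mem_darts hd
    have e1 := p.sum_darts_eq_add (fun x y => φ d.fst x y + φ d.snd x y) f fun e he => by
      have he1 := p.dart_fst_mem_support_of_mem_darts he
      have he2 := p.dart_snd_mem_support_of_mem_darts he
      exact hf _ _ (Or.inl e.adj) (hne _ he1 _ hd1) (hne _ he1 _ hd2) (hne _ he2 _ hd1)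
        (hne _ he2 _ hd2)
    have hu := p.start_mem_support
    have hv := p.end_mem_support
    have e2 := hf u v (Or.inr ⟨rfl, rfl⟩) (hne _ hu _ hd1) (hne _ hu _ hd2) (hne _ hv _ hd1)
        (hne _ hv _ hd2)
    rw [hsum] at e1
    rw [← sub_eq_zero, CharTwo.sub_eq_add]
    linear_combination e1 + e2 + CharTwo.add_self_eq_zero (f u + f v)
  obtain ⟨g, hg, hguv⟩ := hsep
  have ha := q.start_mem_support
  have hb := q.end_mem_support
  have e1 := p.sum_darts_eq_add (fun x y => φ a x y + φ b x y) g fun e he => by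
    have he1 := p.dart_fst_mem_support_of_mem_darts he
    have he2 := p.dart_snd_mem_support_of_mem_darts he
    exact hg _ _ e.adj (hne _ he1 _ ha) (hne _ he1 _ hb) (hne _ he2 _ ha) (hne _ he2 _ hb)
  rw [hsum] at e1
  have h2 : Φ a + Φ b = 1 := by
    linear_combination e1 + hguv + CharTwo.add_self_eq_zero (g u + g v)
  rw [h1, CharTwo.add_self_eq_zero] at h2
  exact zero_ne_one h2

end Crossing

/-- The vertices of a capped cylinder with `n` rings of length `5`: the two caps and the vertices
of the rings. -/
abbrev CappedCylinder (n : ℕ) : Type := Bool ⊕ Fin n × Fin 5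

/-! ### The capped cylinder -/

namespace CappedCylinder

variable {n : ℕ}

/-- Adjacency, in one direction, in the triangulation of the sphere that arises from a cylinder
with `n` rings of length `5` by capping off both ends, with the edge between the vertices `(1, 0)`
and `(1, 1)` omitted. -/
def Step : CappedCylinder n → CappedCylinder n → Prop
  | Sum.inl false, Sum.inr p => p.1.val = 0
  | Sum.inl true, Sum.inr p => p.1.val + 1 = n
  | Sum.inr p, Sum.inr q =>
      (p.1 = q.1 ∧ q.2 = p.2 + 1 ∧ ¬(p.1.val = 1 ∧ p.2 = 0)) ∨
        (p.1.val + 1 = q.1.val ∧ (q.2 = p.2 ∨ q.2 = p.2 + 1))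
  | _, _ => False

/-- The graph with adjacency `Step`. -/
def graph (n : ℕ) : SimpleGraph (CappedCylinder n) := SimpleGraph.fromRel Step

theorem step_ne {x y : CappedCylinder n} (h : Step x y) : x ≠ y := by
  rintro rfl
  rcases x with (_ | _) | ⟨i, j⟩
  · exact h
  · exact h
  · simp [Step] at h

theorem adj_iff {x y : CappedCylinder n} : (graph n).Adj x y ↔ Step x y ∨ Step y x := by
  simp only [graph, fromRel_adj, ne_eq, and_iff_right_iff_imp]
  rintro (h | h)
  · exact step_ne h
  · exact (step_ne h).symm

theorem eq_add_one_iff_val (c d : Fin 5) :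
    d = c + 1 ↔ d.val = c.val + 1 ∨ c.val = 4 ∧ d.val = 0 := by
  revert c d; decide

section Width

/-- An enumeration of the vertices ring by ring. -/
def pos : CappedCylinder n → ℕ
  | Sum.inl false => 0
  | Sum.inl true => 5 * n + 1
  | Sum.inr p => 5 * p.1.val + p.2.val + 1

theorem pos_injective : Function.Injective (pos (n := n)) := by
  rintro ((_ | _) | ⟨i, j⟩) ((_ | _) | ⟨i', j'⟩) h <;>
    simp only [pos] at h <;> first | rfl | omega | skip
  rw [show i = i' by omega, show j = j' by omega]

theorem pos_le_of_step {x y : CappedCylinder n} (h : Step x y) :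
    pos y ≤ pos x + 6 ∧ pos x ≤ pos y + 6 := by
  rcases x with (_ | _) | ⟨i, j⟩ <;> rcases y with (_ | _) | ⟨i', j'⟩ <;>
    simp only [Step, pos] at h ⊢
  · omega
  · omega
  · rcases h with ⟨rfl, h, -⟩ | ⟨h, rfl | h'⟩
    · have := (eq_add_one_iff_val _ _).1 h
      omega
    · omega
    · have := (eq_add_one_iff_val _ _).1 h'
      omega

theorem pos_le_of_adj {x y : CappedCylinder n} (h : (graph n).Adj x y) : pos y ≤ pos x + 6 := by
  rcases adj_iff.1 h with h | h
  · exact (pos_le_of_step h).1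
  · exact (pos_le_of_step h).2

end Width

section Rays

/-- The edges met by the ray that starts just to the right of the vertex in row `i` and column `j`,
runs parallel to column `j` to the first ring, and then turns around the first cap to the face
between the columns `0` and `1`. -/
def Ray (i j : ℕ) : CappedCylinder n → CappedCylinder n → Prop
  | Sum.inl false, Sum.inr q => 1 ≤ q.2.val ∧ q.2.val ≤ j
  | Sum.inr q, Sum.inl false => 1 ≤ q.2.val ∧ q.2.val ≤ j
  | Sum.inr p, Sum.inr q =>
      (p.2.val = j ∧ q.2 = p.2 + 1 ∧ p.1.val < i) ∨ (q.2.val = j ∧ p.2 = q.2 + 1 ∧ q.1.val < i)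
  | _, _ => False

/-- The row of a vertex. -/
def row : CappedCylinder n → ℕ
  | Sum.inl false => 0
  | Sum.inl true => n
  | Sum.inr p => p.1.val

/-- The column of a vertex. -/
def col : CappedCylinder n → ℕ
  | Sum.inl _ => 0
  | Sum.inr p => p.2.val

theorem ray_comm (i j : ℕ) (x y : CappedCylinder n) : Ray i j x y ↔ Ray i j y x := by
  rcases x with (_ | _) | p <;> rcases y with (_ | _) | q <;> simp only [Ray]
  exact or_comm

/-- The region between the rays from the ends of an edge. -/
def Region (w w' : CappedCylinder n) : CappedCylinder n → Prop :=
  match w, w' with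
  | Sum.inl true, Sum.inr q => fun
    | Sum.inr p => 1 ≤ p.2.val ∧ p.2 ≤ q.2
    | _ => False
  | Sum.inr p, Sum.inr q => fun
    | Sum.inr r => q.2 = p.2 + 1 ∧ r.2 = q.2 ∧ r.1.val < q.1.val
    | Sum.inl false => q.2 = p.2 + 1 ∧ p.2 = 4
    | _ => False
  | _, _ => fun _ => False

-- The two rays and the edge ww' bound `Region w w'`, so an edge missing both ends changes sides
-- exactly when it meets one of the rays. The omitted edge is included because it closes up the walk
-- from u to v.
set_option maxHeartbeats 1000000 in
theorem ray_region {w w' x y : CappedCylinder n} (hw : Step w w')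
    (hxy : Step x y ∨ row x = 1 ∧ col x = 0 ∧ row y = 1 ∧ col y = 1 ∧ x.isRight ∧ y.isRight)
    (h1 : x ≠ w) (h2 : x ≠ w') (h3 : y ≠ w) (h4 : y ≠ w') :
    (Ray (row w) (col w) x y ↔ Ray (row w') (col w') x y) ↔ (Region w w' x ↔ Region w w' y) := by
  rcases w with (_ | _) | ⟨⟨i, hi⟩, ⟨j, hj⟩⟩ <;> rcases w' with (_ | _) | ⟨⟨i', hi'⟩, ⟨j', hj'⟩⟩ <;>
    rcases x with (_ | _) | ⟨⟨a, ha⟩, ⟨c, hc⟩⟩ <;> rcases y with (_ | _) | ⟨⟨b, hb⟩, ⟨d, hd⟩⟩ <;>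
    simp only [Step, row, col, Ray, Region, eq_add_one_iff_val, Fin.mk_eq_zero,
      show (4 : Fin 5) = ⟨4, by omega⟩ from rfl, Sum.inr.injEq, Prod.mk.injEq, Fin.mk.injEq, Fin.mk_le_mk, ne_eq,
      Sum.isRight_inr, Sum.isRight_inl, and_false, or_false, and_true, reduceCtorEq,
      not_false_eq_true, not_true_eq_false, iff_true, false_iff, true_iff, Bool.false_eq_true] at *
  · rcases hxy with (⟨rfl, rfl | ⟨rfl, rfl⟩, -⟩ | ⟨rfl, rfl | rfl | ⟨rfl, rfl⟩⟩) |
      ⟨rfl, rfl, rfl, rfl⟩ <;> omega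
  · omega
  · rcases hxy with (⟨rfl, rfl | ⟨rfl, rfl⟩, -⟩ | ⟨rfl, rfl | rfl | ⟨rfl, rfl⟩⟩) |
      ⟨rfl, rfl, rfl, rfl⟩ <;> omega
  · rcases hw with ⟨rfl, rfl | ⟨rfl, rfl⟩, -⟩ | ⟨rfl, rfl | rfl | ⟨rfl, rfl⟩⟩ <;> omega
  · rcases hw with ⟨rfl, rfl | ⟨rfl, rfl⟩, -⟩ | ⟨rfl, rfl | rfl | ⟨rfl, rfl⟩⟩ <;> omega
  · rcases hw with ⟨rfl, rfl | ⟨rfl, rfl⟩, -⟩ | ⟨rfl, rfl | rfl | ⟨rfl, rfl⟩⟩ <;>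
      rcases hxy with (⟨rfl, rfl | ⟨rfl, rfl⟩, -⟩ | ⟨rfl, rfl | rfl | ⟨rfl, rfl⟩⟩) |
        ⟨rfl, rfl, rfl, rfl⟩ <;> omega

end Rays

section Crossing

/-- The region between the rays from the vertices `(0, 0)` and `(2, 1)`. -/
def Separator : CappedCylinder n → Prop
  | Sum.inl _ => False
  | Sum.inr p => p.2.val = 1 ∧ p.1.val < 2

/-- The ray from (0,0) is empty. Of the pairs leaving {(0,1), (1,1)} and missing (0,0) and (2,1),
the ray from (2,1) meets all the edges; only the omitted edge, excluded by `Step`, would escape it.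
-/
theorem ray_separator (hn : 3 ≤ n) {x y : CappedCylinder n} (hxy : Step x y)
    (hx : ¬(x.isRight ∧ row x = 0 ∧ col x = 0)) (hx' : ¬(x.isRight ∧ row x = 2 ∧ col x = 1))
    (hy : ¬(y.isRight ∧ row y = 0 ∧ col y = 0)) (hy' : ¬(y.isRight ∧ row y = 2 ∧ col y = 1)) :
    (Ray 0 0 x y ↔ Ray 2 1 x y) ↔ (Separator x ↔ Separator y) := by
  rcases x with (_ | _) | ⟨⟨a, ha⟩, ⟨c, hc⟩⟩ <;> rcases y with (_ | _) | ⟨⟨b, hb⟩, ⟨d, hd⟩⟩ <;>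
    simp only [Step, row, col, Ray, Separator, eq_add_one_iff_val, Fin.mk_eq_zero, Fin.mk.injEq,
      Sum.isRight_inr, Sum.isRight_inl, true_and, false_iff, true_iff, Bool.false_eq_true] at *
  · omega
  · omega
  · rcases hxy with ⟨rfl, rfl | ⟨rfl, rfl⟩, h⟩ | ⟨rfl, rfl | rfl | ⟨rfl, rfl⟩⟩ <;> omega

open Classical in
/-- The number modulo `2` of times that the ray from `w` meets the edge `xy`. -/
noncomputable def rayParity (w x y : CappedCylinder n) : ZMod 2 :=
  if Ray (row w) (col w) x y then 1 else 0

open Classical in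
theorem indicator_add_eq {p q r s : Prop} (h : (p ↔ q) ↔ (r ↔ s)) :
    ((if p then 1 else 0) + (if q then 1 else 0) : ZMod 2) =
      (if r then 1 else 0) + (if s then 1 else 0) := by
  by_cases hp : p <;> by_cases hq : q <;> by_cases hr : r <;> by_cases hs : s <;>
    simp_all [CharTwo.add_self_eq_zero]

theorem rayParity_comm (w x y : CappedCylinder n) : rayParity w x y = rayParity w y x := by
  classical
  exact if_congr (ray_comm _ _ _ _) rfl rfl

theorem exists_mem_support (hn : 3 ≤ n)
    (p : (graph n).Walk (Sum.inr (⟨1, by omega⟩, 0)) (Sum.inr (⟨1, by omega⟩, 1)))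
    (q : (graph n).Walk (Sum.inr (⟨0, by omega⟩, 0)) (Sum.inr (⟨2, by omega⟩, 1))) :
    ∃ x ∈ p.support, x ∈ q.support := by
  classical
  refine exists_mem_support_of_rays rayParity ?_ ?_ p q
  · have key : ∀ w w' : CappedCylinder n, Step w w' → ∃ f : CappedCylinder n → ZMod 2, ∀ x y,
        ((graph n).Adj x y ∨ x = Sum.inr (⟨1, by omega⟩, 0) ∧ y = Sum.inr (⟨1, by omega⟩, 1)) →
        x ≠ w → x ≠ w' → y ≠ w → y ≠ w' → rayParity w x y + rayParity w' x y = f x + f y := by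
      intro w w' hw
      refine ⟨fun x => if Region w w' x then 1 else 0, fun x y hxy h1 h2 h3 h4 => ?_⟩
      rw [adj_iff] at hxy
      rcases hxy with (h | h) | ⟨rfl, rfl⟩
      · exact indicator_add_eq (ray_region hw (Or.inl h) h1 h2 h3 h4)
      · rw [rayParity_comm w, rayParity_comm w', add_comm (ite _ _ _)]
        exact indicator_add_eq (ray_region hw (Or.inl h) h3 h4 h1 h2)
      · exact indicator_add_eq (ray_region hw (Or.inr (by simp [row, col])) h1 h2 h3 h4)
    intro w w' h
    rcases adj_iff.1 h with h | h
    · exact key w w' h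
    · obtain ⟨f, hf⟩ := key w' w h
      refine ⟨f, fun x y hxy h1 h2 h3 h4 => ?_⟩
      rw [add_comm]
      exact hf x y hxy h2 h1 h4 h3
  · have key : ∀ (x : CappedCylinder n) (i : ℕ) (hi : i < n) (j : Fin 5), x ≠ Sum.inr (⟨i, hi⟩, j) →
        ¬(x.isRight ∧ row x = i ∧ col x = j.val) := by
      rintro (_ | ⟨a, c⟩) i hi j h ⟨h1, h2, h3⟩
      · simp at h1
      · exact h (by rw [show a = ⟨i, hi⟩ from Fin.ext h2, show c = j from Fin.ext h3])
    refine ⟨fun x => if Separator x then 1 else 0, fun x y hxy h1 h2 h3 h4 => ?_, ?_⟩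
    · rcases adj_iff.1 hxy with h | h
      · exact indicator_add_eq
          (ray_separator hn h (key _ _ _ _ h1) (key _ _ _ _ h2) (key _ _ _ _ h3) (key _ _ _ _ h4))
      · rw [rayParity_comm _ x, rayParity_comm _ x, add_comm (ite _ _ _)]
        exact indicator_add_eq
          (ray_separator hn h (key _ _ _ _ h3) (key _ _ _ _ h4) (key _ _ _ _ h1) (key _ _ _ _ h2))
    · simp [rayParity, Ray, Separator, row, col, CharTwo.add_self_eq_zero]

end Crossing

/-! ### 5-connectivity of the capped cylinder -/

section Connectivity

variable {X : Finset (CappedCylinder n)}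

theorem reachable_of_step {x y : CappedCylinder n} (h : Step x y) (hx : x ∉ X) (hy : y ∉ X) :
    ((graph n).avoiding X).Reachable x y :=
  Adj.reachable ⟨adj_iff.2 (Or.inl h), hx, hy⟩

theorem reachable_down {i i' : Fin n} (h : i.val + 1 = i'.val) {j : Fin 5}
    (h1 : Sum.inr (i, j) ∉ X) (h2 : Sum.inr (i', j) ∉ X) :
    ((graph n).avoiding X).Reachable (Sum.inr (i, j)) (Sum.inr (i', j)) :=
  reachable_of_step (Or.inr ⟨h, Or.inl rfl⟩) h1 h2

theorem reachable_diag {i i' : Fin n} (h : i.val + 1 = i'.val) {j j' : Fin 5} (hj : j' = j + 1)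
    (h1 : Sum.inr (i, j) ∉ X) (h2 : Sum.inr (i', j') ∉ X) :
    ((graph n).avoiding X).Reachable (Sum.inr (i, j)) (Sum.inr (i', j')) :=
  reachable_of_step (Or.inr ⟨h, Or.inr hj⟩) h1 h2

theorem reachable_ring_of_ne {i : Fin n} {j j' : Fin 5} (hj : j' = j + 1)
    (hij : ¬(i.val = 1 ∧ j = 0)) (h1 : Sum.inr (i, j) ∉ X) (h2 : Sum.inr (i, j') ∉ X) :
    ((graph n).avoiding X).Reachable (Sum.inr (i, j)) (Sum.inr (i, j')) :=
  reachable_of_step (Or.inl ⟨rfl, hj, hij⟩) h1 h2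

theorem reachable_top {i : Fin n} (h : i.val = 0) {j : Fin 5} (h1 : Sum.inl false ∉ X)
    (h2 : Sum.inr (i, j) ∉ X) :
    ((graph n).avoiding X).Reachable (Sum.inl false) (Sum.inr (i, j)) :=
  reachable_of_step h h1 h2

theorem reachable_bot {i : Fin n} (h : i.val + 1 = n) {j : Fin 5} (h1 : Sum.inl true ∉ X)
    (h2 : Sum.inr (i, j) ∉ X) :
    ((graph n).avoiding X).Reachable (Sum.inl true) (Sum.inr (i, j)) :=
  reachable_of_step h h1 h2

/-- A partition of the vertices into five parts, each of which contains the interior of a path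
between the ends `(1, 0)` and `(1, 1)` of the omitted edge. -/
def detour : CappedCylinder n → Fin 5
  | Sum.inl _ => 0
  | Sum.inr p =>
      if p.1.val = 0 then (if p.2 = 0 then 1 else 2)
      else if p.1.val = 1 then 0
      else if p.2 = 1 then 3 else 4

/-- Four deletions miss one of five detours: around ring 1, through (0,0), around the rest of ring
0, through (2,1), or around the rest of ring 2. -/
theorem reachable_omitted (hn : 3 ≤ n) (hX : X.card < 5) {i : Fin n} (hi : i.val = 1)
    (hu : Sum.inr (i, 0) ∉ X) (hv : Sum.inr (i, 1) ∉ X) :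
    ((graph n).avoiding X).Reachable (Sum.inr (i, 0)) (Sum.inr (i, 1)) := by
  obtain ⟨c, hc⟩ := exists_fiber_avoiding (detour (n := n)) X (by simpa using hX)
  have h0 : ∀ j, detour (Sum.inr ((⟨0, by omega⟩ : Fin n), j)) = if j = 0 then 1 else 2 :=
    fun j => by simp [detour]
  have h1 : ∀ j, detour (Sum.inr (i, j)) = 0 := fun j => by simp [detour, hi]
  have h2 : ∀ j, detour (Sum.inr ((⟨2, by omega⟩ : Fin n), j)) = if j = 1 then 3 else 4 :=
    fun j => by simp [detour]
  have hi0 : (⟨0, by omega⟩ : Fin n).val + 1 = i.val := by simp [hi]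
  have hi2 : i.val + 1 = (⟨2, by omega⟩ : Fin n).val := by simp [hi]
  have c0 := fun j h => hc _ ((h0 j).trans h)
  have c1 := fun j h => hc _ ((h1 j).trans h)
  have c2 := fun j h => hc _ ((h2 j).trans h)
  obtain rfl | rfl | rfl | rfl | rfl : c = 0 ∨ c = 1 ∨ c = 2 ∨ c = 3 ∨ c = 4 := by
    clear * -; revert c; decide
  · have c1 := fun j => c1 j rfl
    exact ((reachable_ring_of_ne (j := 4) rfl (by simp) (c1 4) (c1 0)).symm.trans
      (reachable_ring_of_ne (j := 3) rfl (by simp) (c1 3) (c1 4)).symm).trans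
      ((reachable_ring_of_ne (j := 2) rfl (by simp) (c1 2) (c1 3)).symm.trans
      (reachable_ring_of_ne (j := 1) rfl (by simp) (c1 1) (c1 2)).symm)
  · have c0 := c0 0 rfl
    exact (reachable_down hi0 c0 hu).symm.trans (reachable_diag hi0 rfl c0 hv)
  · have hr := fun j k (h : k = j + 1) hj hk => reachable_ring_of_ne (X := X)
      (i := (⟨0, by omega⟩ : Fin n)) h (by simp) (c0 j hj) (c0 k hk)
    exact ((reachable_diag hi0 rfl (c0 4 rfl) hu).symm.trans (hr 3 4 rfl rfl rfl).symm).trans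
      ((hr 2 3 rfl rfl rfl).symm.trans ((hr 1 2 rfl rfl rfl).symm.trans
        (reachable_down hi0 (c0 1 rfl) hv)))
  · have c2 := c2 1 rfl
    exact (reachable_diag hi2 rfl hu c2).trans (reachable_down hi2 hv c2).symm
  · have hr := fun j k (h : k = j + 1) hj hk => reachable_ring_of_ne (X := X)
      (i := (⟨2, by omega⟩ : Fin n)) h (by simp) (c2 j hj) (c2 k hk)
    exact ((reachable_down hi2 hu (c2 0 rfl)).trans (hr 4 0 rfl rfl rfl).symm).trans
      ((hr 3 4 rfl rfl rfl).symm.trans ((hr 2 3 rfl rfl rfl).symm.trans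
        (reachable_diag hi2 rfl hv (c2 2 rfl)).symm))

theorem reachable_ring (hn : 3 ≤ n) (hX : X.card < 5) {i : Fin n} {j j' : Fin 5} (hj : j' = j + 1)
    (h1 : Sum.inr (i, j) ∉ X) (h2 : Sum.inr (i, j') ∉ X) :
    ((graph n).avoiding X).Reachable (Sum.inr (i, j)) (Sum.inr (i, j')) := by
  by_cases hij : i.val = 1 ∧ j = 0
  · obtain ⟨hi, rfl⟩ := hij
    subst hj
    exact reachable_omitted hn hX hi h1 h2
  · exact reachable_ring_of_ne hj hij h1 h2

/-- A ring which has lost at most one vertex is still connected. -/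
theorem reachable_of_ring (hn : 3 ≤ n) (hX : X.card < 5) {i : Fin n}
    (hi : ∃ c, ∀ j, j ≠ c → Sum.inr (i, j) ∉ X) {j j' : Fin 5}
    (h1 : Sum.inr (i, j) ∉ X) (h2 : Sum.inr (i, j') ∉ X) :
    ((graph n).avoiding X).Reachable (Sum.inr (i, j)) (Sum.inr (i, j')) := by
  -- Arrange that both ends lie on the path c+1, …, c+4; if the ring is intact, any third column
  -- serves as `c`.
  obtain ⟨c, hc, hjc, hjc'⟩ : ∃ c, (∀ j, j ≠ c → Sum.inr (i, j) ∉ X) ∧ j ≠ c ∧ j' ≠ c := by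
    obtain ⟨c, hc⟩ := hi
    by_cases hcX : Sum.inr (i, c) ∈ X
    · exact ⟨c, hc, fun h => h1 (h ▸ hcX), fun h => h2 (h ▸ hcX)⟩
    · have hall : ∀ j, Sum.inr (i, j) ∉ X := fun j =>
        if h : j = c then h ▸ hcX else hc j h
      obtain ⟨d, hd⟩ : ∃ d, j ≠ d ∧ j' ≠ d := by
        clear * -; revert j j'; decide
      exact ⟨d, fun j _ => hall j, hd⟩
  have key : ∀ j, j ≠ c →
      ((graph n).avoiding X).Reachable (Sum.inr (i, c + 1)) (Sum.inr (i, j)) := by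
    have m : ∀ d, d ≠ 0 → Sum.inr (i, c + d) ∉ X := fun d hd => hc _ (by simpa using hd)
    have r1 := reachable_ring hn hX (j' := c + 2) (by rw [add_assoc]; rfl) (m 1 (by decide))
      (m 2 (by decide))
    have r2 := reachable_ring hn hX (j' := c + 3) (by rw [add_assoc]; rfl) (m 2 (by decide))
      (m 3 (by decide))
    have r3 := reachable_ring hn hX (j' := c + 4) (by rw [add_assoc]; rfl) (m 3 (by decide))
      (m 4 (by decide))
    intro j hj
    obtain rfl | rfl | rfl | rfl : j = c + 1 ∨ j = c + 2 ∨ j = c + 3 ∨ j = c + 4 := by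
      clear * - hj; revert c j; decide
    · exact Reachable.refl _
    · exact r1
    · exact r1.trans r2
    · exact (r1.trans r2).trans r3
  exact (key j hjc).symm.trans (key j' hjc')

theorem exists_pair_of_not_ring {i : Fin n} (hi : ¬∃ c, ∀ j, j ≠ c → Sum.inr (i, j) ∉ X) :
    ∃ c d, c ≠ d ∧ Sum.inr (i, c) ∈ X ∧ Sum.inr (i, d) ∈ X := by
  push Not at hi
  obtain ⟨c, -, hc⟩ := hi 0
  obtain ⟨d, hd, hdX⟩ := hi c
  exact ⟨c, d, hd.symm, hc, hdX⟩

/-- The capped cylinder is `5`-connected. -/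
theorem reachable_avoiding (hn : 3 ≤ n) (hX : X.card < 5) {x y : CappedCylinder n} (hx : x ∉ X)
    (hy : y ∉ X) : ((graph n).avoiding X).Reachable x y := by
  -- Some column is untouched (the caps are counted in column 0); every surviving vertex will be
  -- linked to it.
  obtain ⟨j, hj⟩ : ∃ j : Fin 5, ∀ i : Fin n, Sum.inr (i, j) ∉ X := by
    obtain ⟨c, hc⟩ := exists_fiber_avoiding
      (fun x : CappedCylinder n => (Sum.elim (fun _ => 0) Prod.snd x : Fin 5)) X (by simpa using hX)
    exact ⟨c, fun i => hc _ rfl⟩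
  let o : Fin n := ⟨0, by omega⟩
  have hcol : ∀ (a : ℕ) (ha : a < n),
      ((graph n).avoiding X).Reachable (Sum.inr (o, j)) (Sum.inr (⟨a, ha⟩, j)) := by
    intro a
    induction a with
    | zero => exact fun _ => Reachable.refl _
    | succ a ih => exact fun ha => (ih (by omega)).trans (reachable_down rfl (hj _) (hj _))
  have hring : ∀ i : Fin n, (∃ c, ∀ j, j ≠ c → Sum.inr (i, j) ∉ X) → ∀ c, Sum.inr (i, c) ∉ X →
      ((graph n).avoiding X).Reachable (Sum.inr (o, j)) (Sum.inr (i, c)) := fun i hi c hc =>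
    (hcol i.val i.isLt).trans (reachable_of_ring hn hX hi (hj i) hc)
  have main : ∀ x, x ∉ X → ((graph n).avoiding X).Reachable (Sum.inr (o, j)) x := by
    rintro ((_ | _) | ⟨i, c⟩) hx
    · exact (reachable_top rfl hx (hj _)).symm
    · exact (hcol (n - 1) (by omega)).trans
        (reachable_bot (by simp only; omega) hx (hj _)).symm
    by_cases hi : ∃ c, ∀ j, j ≠ c → Sum.inr (i, j) ∉ X
    · exact hring i hi c hx
    -- A vertex has two neighbours in each adjacent ring, so one survives if that ring lost at most
    -- one vertex.
    by_cases hlow : ∃ i' : Fin n, i.val + 1 = i'.val ∧ ∃ c, ∀ j, j ≠ c → Sum.inr (i', j) ∉ X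
    · obtain ⟨i', hi', d, hd⟩ := hlow
      by_cases hcd : c = d
      · have h := hd (c + 1) (by rw [hcd]; simp)
        exact (hring i' ⟨d, hd⟩ _ h).trans (reachable_diag hi' rfl hx h).symm
      · have h := hd c hcd
        exact (hring i' ⟨d, hd⟩ _ h).trans (reachable_down hi' hx h).symm
    by_cases hupp : ∃ i' : Fin n, i'.val + 1 = i.val ∧ ∃ c, ∀ j, j ≠ c → Sum.inr (i', j) ∉ X
    · obtain ⟨i', hi', d, hd⟩ := hupp
      by_cases hcd : c = d
      · have h := hd (c - 1) (by rw [hcd]; simp)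
        exact (hring i' ⟨d, hd⟩ _ h).trans (reachable_diag hi' (by simp) h hx)
      · have h := hd c hcd
        exact (hring i' ⟨d, hd⟩ _ h).trans (reachable_down hi' h hx)
    -- Now this ring and every adjacent ring lost at least two vertices. Two such rings exhaust `X`,
    -- so the ring is the first or last and its cap survives.
    obtain ⟨c1, d1, hcd1, hc1, hd1⟩ := exists_pair_of_not_ring hi
    have hlow' : ∀ i' : Fin n, i.val + 1 = i'.val →
        ∃ c d, c ≠ d ∧ Sum.inr (i', c) ∈ X ∧ Sum.inr (i', d) ∈ X :=
      fun i' hi' => exists_pair_of_not_ring fun h => hlow ⟨i', hi', h⟩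
    have hupp' : ∀ i' : Fin n, i'.val + 1 = i.val →
        ∃ c d, c ≠ d ∧ Sum.inr (i', c) ∈ X ∧ Sum.inr (i', d) ∈ X :=
      fun i' hi' => exists_pair_of_not_ring fun h => hupp ⟨i', hi', h⟩
    have hfour : ∀ i' : Fin n, i' ≠ i → ∀ c2 d2, c2 ≠ d2 → Sum.inr (i', c2) ∈ X →
        Sum.inr (i', d2) ∈ X → ∀ z ∈ X, z = Sum.inr (i, c1) ∨ z = Sum.inr (i, d1) ∨
          z = Sum.inr (i', c2) ∨ z = Sum.inr (i', d2) := by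
      intro i' hii c2 d2 hcd2 hc2 hd2 z hz
      by_contra! hne
      have hsub : ({z, Sum.inr (i, c1), Sum.inr (i, d1), Sum.inr (i', c2), Sum.inr (i', d2)} :
          Finset (CappedCylinder n)) ⊆ X := by
        intro w hw
        simp only [Finset.mem_insert, Finset.mem_singleton] at hw
        rcases hw with rfl | rfl | rfl | rfl | rfl <;> assumption
      have := Finset.card_le_card hsub
      rw [Finset.card_insert_of_notMem (by simpa using hne),
        Finset.card_insert_of_notMem (by simp [hcd1, hii.symm]),
        Finset.card_insert_of_notMem (by simp [hii.symm]),
        Finset.card_pair (by simp [hcd2])] at this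
      omega
    by_cases h0 : i.val = 0
    · obtain ⟨c2, d2, hcd2, hc2, hd2⟩ := hlow' ⟨i.val + 1, by omega⟩ rfl
      have htop : Sum.inl false ∉ X := fun h => by
        simpa using hfour _ (by simp [Fin.ext_iff]) c2 d2 hcd2 hc2 hd2 _ h
      exact (reachable_top rfl htop (hj o)).symm.trans (reachable_top h0 htop hx)
    · obtain ⟨c2, d2, hcd2, hc2, hd2⟩ := hupp' ⟨i.val - 1, by omega⟩ (by simp only; omega)
      have h4 := hfour _ (by simp only [ne_eq, Fin.ext_iff]; omega) c2 d2 hcd2 hc2 hd2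
      by_cases hlast : i.val + 1 = n
      · have hbot : Sum.inl true ∉ X := fun h => by simpa using h4 _ h
        exact (hcol (n - 1) (by omega)).trans
          ((reachable_bot (by simp only; omega) hbot (hj _)).symm.trans
            (reachable_bot hlast hbot hx))
      · obtain ⟨c3, d3, -, hc3, -⟩ := hlow' ⟨i.val + 1, by omega⟩ rfl
        have := h4 _ hc3
        simp only [Sum.inr.injEq, Prod.mk.injEq, Fin.ext_iff] at this
        omega
  exact (main x hx).symm.trans (main y hy)

end Connectivity

end CappedCylinder

/-! ### Failure of linkage and the final bounds -/

theorem not_isLinked_joinEdgeless {n : ℕ} (hn : 3 ≤ n) (m : ℕ) :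
    ¬ ((CappedCylinder.graph n).joinEdgeless (Fin m ⊕ Fin m)).IsLinked (m + 2) := by
  intro h
  let w (i : ℕ) (hi : i < 3) (j : Fin 5) : CappedCylinder n ⊕ (Fin m ⊕ Fin m) :=
    Sum.inl (Sum.inr (⟨i, by omega⟩, j))
  let s : Fin (m + 2) → CappedCylinder n ⊕ (Fin m ⊕ Fin m) :=
    Fin.cons (w 1 (by omega) 0) (Fin.cons (w 0 (by omega) 0) fun i => Sum.inr (Sum.inl i))
  let t : Fin (m + 2) → CappedCylinder n ⊕ (Fin m ⊕ Fin m) :=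
    Fin.cons (w 1 (by omega) 1) (Fin.cons (w 2 (by omega) 1) fun i => Sum.inr (Sum.inr i))
  have hinj : Function.Injective (Sum.elim s t) := by
    rw [Sum.elim_injective]
    refine ⟨?_, ?_, ?_⟩ <;> intro i j <;>
      refine Fin.cases ?_ (fun i => Fin.cases ?_ (fun i => ?_) i) i <;>
        refine Fin.cases ?_ (fun j => Fin.cases ?_ (fun j => ?_) j) j <;> simp [s, t, w]
  obtain ⟨P, hP⟩ := h s t hinj
  have havoid : ∀ i : Fin (m + 2), (i = 0 ∨ i = 1) → ∀ z, Sum.inr z ∉ (P i).1.support := by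
    rintro i hi (z | z) hz
    · refine hP i z.succ.succ ?_ hz ?_
      · rcases hi with rfl | rfl <;> simp [Fin.ext_iff]
      · exact (P z.succ.succ).1.start_mem_support
    · refine hP i z.succ.succ ?_ hz ?_
      · rcases hi with rfl | rfl <;> simp [Fin.ext_iff]
      · exact (P z.succ.succ).1.end_mem_support
  obtain ⟨p, hp⟩ := exists_walk_of_joinEdgeless (P 0).1 (havoid 0 (Or.inl rfl))
  obtain ⟨q, hq⟩ := exists_walk_of_joinEdgeless (P 1).1 (havoid 1 (Or.inr rfl))
  obtain ⟨x, hxp, hxq⟩ := CappedCylinder.exists_mem_support hn p q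
  exact hP 0 1 (by simp) (hp x hxp) (hq x hxq)

end SimpleGraph

theorem mainTheorem4 (k N : ℕ) (hk : 2 ≤ k) :
    ∃ (V : Type) (_ : Fintype V) (G : SimpleGraph V),
      ¬ G.IsLinked k ∧
      ((2 * k + 1 : ℕ) : ℕ∞) ≤ G.connectivity ∧
      G.treewidth ≤ ((2 * k + 10 : ℕ) : ℕ∞) ∧
      N ≤ Fintype.card V := by
  obtain ⟨m, rfl⟩ := Nat.exists_eq_add_of_le' hk
  -- Three rings are needed around the omitted edge; `N` gives the order, and `m` ensures that 5n +
  -- 2 exceeds 5 + 2m, as the join lemma requires.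
  let n := N + m + 3
  have hcard : Fintype.card (SimpleGraph.CappedCylinder n) = 2 + n * 5 := by simp
  refine ⟨SimpleGraph.CappedCylinder n ⊕ (Fin m ⊕ Fin m), inferInstance,
    (SimpleGraph.CappedCylinder.graph n).joinEdgeless (Fin m ⊕ Fin m),
    SimpleGraph.not_isLinked_joinEdgeless (by omega) m, ?_, ?_, ?_⟩
  · have h := SimpleGraph.isVertexConnected_joinEdgeless (K := Fin m ⊕ Fin m)
      (G := SimpleGraph.CappedCylinder.graph n)
      (p := 5) (by rw [hcard]; simp; omega)
      fun X hX x y hx hy => SimpleGraph.CappedCylinder.reachable_avoiding (by omega) hX hx hy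
    rw [show 2 * (m + 2) + 1 = 5 + Fintype.card (Fin m ⊕ Fin m) by simp; omega]
    exact SimpleGraph.le_connectivity h
  · refine (SimpleGraph.treewidth_le_of_bandwidth _ (Set.range Sum.inr)
      (Sum.elim SimpleGraph.CappedCylinder.pos fun _ => 0) 6 (2 * m) ?_ ?_ ?_).trans ?_
    · rw [← Set.image_univ, Sum.inr_injective.encard_image, Set.encard_univ,
        ENat.card_eq_coe_fintype_card]
      simp
      ring_nf
      rfl
    · rintro (x | x) hx (y | y) hy h
      · exact congrArg _ (SimpleGraph.CappedCylinder.pos_injective h)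
      all_goals simp at hx hy
    · rintro (x | x) (y | y) h hx hy
      · exact SimpleGraph.CappedCylinder.pos_le_of_adj (SimpleGraph.joinEdgeless_adj_inl.1 h)
      all_goals simp at hx hy
    · exact_mod_cast (by omega)
  · rw [Fintype.card_sum, hcard]
    omega
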